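/- Let $n\ge 1$, let $x_1,\dots,x_n$ be fixed points of a set $\mathcal X$ and let $f_0:\mathcal X\to\mathbb R$. For $f:\mathcal X\to\mathbb R$ put $\pi_f(x)=e^{f(x)}/(1+e^{f(x)})$ and let $\mathbb P_f^{(n)}$ be the law on $\{0,1\}^n$ of independent variables $Y_1,\dots,Y_n$, where $Y_i$ is Bernoulli with parameter $\pi_f(x_i)$. The observation $(Y_1,\dots,Y_n)$ has law $\mathbb P_{f_0}^{(n)}$, and $\mathbb E_{f_0}$ is the expectation under this law. Put $$\gamma_n(f)=-\frac1n\log\prod_{i=1}^n\pi_f(x_i)^{Y_i}(1-\pi_f(x_i))^{1-Y_i},\qquad \gamma(f)=\mathbb E_{f_0}[\gamma_n(f)],$$ $$\mathcal K(\mathbb P_{f_0}^{(n)},\mathbb P_f^{(n)})=\frac1n\int\log\frac{d\mathbb P_{f_0}^{(n)}}{d\mathbb P_f^{(n)}}\,d\mathbb P_{f_0}^{(n)},\qquad \|f\|_n^2=\frac1n\sum_{i=1}^n f(x_i)^2 .$$ Let $(\phi_j)_{j\in J}$ be a family of functions $\mathcal X\to\mathbb R$ and $\mathcal M$ a collection of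 finite subsets of $J$ (for instance all subsets of $J=\{1,\dots,M\}$). For $m\in\mathcal M$ let $\mathcal S_m$ be the linear span of $\{\phi_j : j\in m\}$ and $D_m$ its dimension. For $C_0>0$ let $\mathbb L_\infty(C_0)=\{f:\mathcal X\to\mathbb R : \max_i|f(x_i)|\le C_0\}$ and let $$\hat f_m\in\arg\min_{t\in\mathcal S_m\cap\mathbb L_\infty(C_0)}\gamma_n(t),\qquad f_m\in\arg\min_{t\in\mathcal S_m\cap\mathbb L_\infty(C_0)}\gamma(t).$$ **Theorem.** For all $c_1>0$ and $C_0>0$ there are positive constants $\lambda,C,C',C_1,C_1'$, depending only on $c_1$ and $C_0$, such that the following holds for all $n,\mathcal X,x_i,f_0,(\phi_j)_{j\in J},\mathcal M$ as above. Assume that $\max_{1\le i\le n}|f_0(x_i)|\le c_1$. Let $(L_m)_{m\in\mathcal M}$ be positive numbers with $\Sigma=\sum_{m\in\mathcal M}\exp(-L_mD_m)<\infty$, let $\mathrm{pen}:\mathcal M\to\mathbb R_+$ satisfy $$\mathrm{pen}(m)\ge\lambda\frac{D_m}{n}\Big(\frac12+\sqrt{5L_m}\Big)^2\qquad(m\in\mathcal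 M),$$ and let $\hat m\in\arg\min_{m\in\mathcal M}\{\gamma_n(\hat f_m)+\mathrm{pen}(m)\}$, where $\hat f_m$ and $\hat m$ are functions of the observation $(Y_1,\dots,Y_n)$. Then $$\mathbb E_{f_0}\big[\mathcal K(\mathbb P_{f_0}^{(n)},\mathbb P_{\hat f_{\hat m}}^{(n)})\big]\le C\inf_{m\in\mathcal M}\big\{\mathcal K(\mathbb P_{f_0}^{(n)},\mathbb P_{f_m}^{(n)})+\mathrm{pen}(m)\big\}+C_1\frac{\Sigma}{n}$$ and $$\mathbb E_{f_0}\big[\|\hat f_{\hat m}-f_0\|_n^2\big]\le C'\inf_{m\in\mathcal M}\big\{\|f_0-f_m\|_n^2+\mathrm{pen}(m)\big\}+C_1'\frac{\Sigma}{n}.$$ -/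

import Mathlib

open MeasureTheory

noncomputable section

namespace LogisticSelection

/-- The logistic function `e^t / (1 + e^t)`, so that `π_f(x) = logistic (f x)`. -/
def logistic (t : ℝ) : ℝ := Real.exp t / (1 + Real.exp t)

theorem logistic_mem (t : ℝ) : logistic t ∈ unitInterval := by
  have h := Real.exp_pos t
  refine ⟨by unfold logistic; positivity, ?_⟩
  unfold logistic
  rw [div_le_one (by positivity)]
  linarith

variable {X : Type*} {n : ℕ}

/-- The law `ℙ_f^{(n)}` of `(Y₁, …, Yₙ)` on `{0,1}ⁿ` (with `true` for `1` and `false` for `0`):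
the `Yᵢ` are independent and `Yᵢ` is Bernoulli with parameter `π_f(xᵢ)`. -/
def law (x : Fin n → X) (f : X → ℝ) : Measure (Fin n → Bool) :=
  Measure.pi fun i =>
    ProbabilityTheory.bernoulliMeasure true false ⟨logistic (f (x i)), logistic_mem (f (x i))⟩

/-- The likelihood `Lₙ(f) = ∏ᵢ π_f(xᵢ)^{Yᵢ} (1 - π_f(xᵢ))^{1 - Yᵢ}` at the data `y`. -/
def likelihood (x : Fin n → X) (f : X → ℝ) (y : Fin n → Bool) : ℝ :=
  ∏ i, if y i = true then logistic (f (x i)) else 1 - logistic (f (x i))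

/-- The empirical contrast `γₙ(f) = -(1/n) log Lₙ(f)` at the data `y`. -/
def empContrast (x : Fin n → X) (f : X → ℝ) (y : Fin n → Bool) : ℝ :=
  -(1 / (n : ℝ)) * Real.log (likelihood x f y)

/-- The contrast `γ(f) = 𝔼_{f₀}[γₙ(f)]`. -/
def contrast (x : Fin n → X) (f₀ f : X → ℝ) : ℝ :=
  ∫ y, empContrast x f y ∂(law x f₀)

/-- The normalized Kullback–Leibler divergence
`𝒦(ℙ_f^{(n)}, ℙ_g^{(n)}) = (1/n) ∫ log (dℙ_f^{(n)} / dℙ_g^{(n)}) dℙ_f^{(n)}`. -/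
def kl (x : Fin n → X) (f g : X → ℝ) : ℝ :=
  1 / (n : ℝ) * (InformationTheory.klDiv (law x f) (law x g)).toReal

/-- The squared empirical norm `‖f‖ₙ² = (1/n) ∑ᵢ f(xᵢ)²`. -/
def empNormSq (x : Fin n → X) (f : X → ℝ) : ℝ :=
  1 / (n : ℝ) * ∑ i, f (x i) ^ 2

/-- The model `S_m`: the linear combinations of the functions `φ_j`, `j ∈ m`. -/
def model {J : Type*} (φ : J → X → ℝ) (m : Finset J) : Submodule ℝ (X → ℝ) :=
  Submodule.span ℝ (φ '' (m : Set J))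

/-- The dimension `D_m` of the span of `{φ_j, j ∈ m}`. -/
def modelDim {J : Type*} (φ : J → X → ℝ) (m : Finset J) : ℕ :=
  Module.finrank ℝ (model φ m)

/-- `𝕃_∞(C₀)`: the functions bounded by `C₀` in absolute value at the design points. -/
def supBall (x : Fin n → X) (C₀ : ℝ) : Set (X → ℝ) :=
  {f | ∀ i, |f (x i)| ≤ C₀}

/-- `t` is a minimizer of `F` over `S`. -/
def IsArgmin {α : Type*} (F : α → ℝ) (S : Set α) (t : α) : Prop :=
  t ∈ S ∧ ∀ s ∈ S, F t ≤ F s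

end LogisticSelection

end

/-!
The log-likelihood of the logistic model is linear in the data, so `γₙ - γ` is a linear form in the
centred noise `Yᵢ - π_{f₀}(xᵢ)`, while the Kullback–Leibler risk is the excess contrast. Since
`e^{-B} / 4 ≤ π (1 - π) ≤ 1 / 4` for log-odds in `[-B, B]`, this risk is equivalent to `‖f - f₀‖ₙ²`.

Compare the penalized criterion at the selected estimator with its value at a competitor `h`. The
linear form at their difference is controlled, by Cauchy–Schwarz and Young, by half of the two risks
and a multiple of `χ² / n`, where `χ²` is the squared norm of the projection of the noise onto the
design values of `S_m̂ + ℝ h`, a space of dimension at most `D + 1`.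

By Hoeffding the noise is a sub-Gaussian vector with variance proxy `1 / 4`. Writing `e^{t ‖z‖²}` as
the average of `e^{⟨√(2t) z, g⟩}` over a standard Gaussian vector `g` and exchanging the integrals
gives `𝔼 e^{χ²} ≤ e^{(D + 1) / 2}`. The penalty absorbs `D / 2 + L D`, and what remains of `χ²` is
at most `exp (χ² - (D + 1) / 2 - L D)`, of expectation at most `e^{-L D}`; summing over the models
accounts for the random choice of `m̂` and produces `Σ`.
-/

noncomputable section

namespace LogisticSelection

section Convexity

theorem add_mul_sub_le_of_convexOn {s : Set ℝ} {f : ℝ → ℝ} (hf : ConvexOn ℝ s f) {f' u v : ℝ}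
    (hu : u ∈ s) (hv : v ∈ s) (hd : HasDerivAt f f' u) : f u + f' * (v - u) ≤ f v := by
  rcases lt_trichotomy u v with h | rfl | h
  · have := hf.le_slope_of_hasDerivAt hu hv h hd
    rw [slope_def_field, le_div_iff₀ (sub_pos.2 h)] at this
    linarith
  · simp
  · have := hf.slope_le_of_hasDerivAt hv hu h hd
    rw [slope_def_field, div_le_iff₀ (sub_pos.2 h)] at this
    linarith

theorem add_mul_sub_add_sq_le_of_le_deriv2 {s : Set ℝ} (hs : Convex ℝ s) {f f' f'' : ℝ → ℝ}
    {c : ℝ} (hf : ∀ t ∈ s, HasDerivAt f (f' t) t) (hf' : ∀ t ∈ s, HasDerivAt f' (f'' t) t)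
    (hc : ∀ t ∈ s, c ≤ f'' t) {u v : ℝ} (hu : u ∈ s) (hv : v ∈ s) :
    f u + f' u * (v - u) + c / 2 * (v - u) ^ 2 ≤ f v := by
  have hd : ∀ t ∈ s, HasDerivAt (fun t => f t - c / 2 * t ^ 2) (f' t - c * t) t := fun t ht =>
    ((hf t ht).sub ((hasDerivAt_pow 2 t).const_mul (c / 2))).congr_deriv (by simp; ring)
  have hd' : ∀ t ∈ s, HasDerivAt (fun t => f' t - c * t) (f'' t - c) t := fun t ht =>
    ((hf' t ht).sub ((hasDerivAt_id t).const_mul c)).congr_deriv (by simp)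
  have hconv : ConvexOn ℝ s fun t => f t - c / 2 * t ^ 2 :=
    convexOn_of_hasDerivWithinAt2_nonneg hs
      (fun t ht => (hd t ht).continuousAt.continuousWithinAt)
      (fun t ht => (hd t (interior_subset ht)).hasDerivWithinAt)
      (fun t ht => (hd' t (interior_subset ht)).hasDerivWithinAt)
      fun t ht => sub_nonneg.2 (hc t (interior_subset ht))
  have := add_mul_sub_le_of_convexOn hconv hu hv (hd u hu)
  linear_combination this

end Convexity

section Logistic

/-- The log-partition function `log (1 + e^t)` of the Bernoulli family in its natural parameter. -/
def logPartition (t : ℝ) : ℝ := Real.log (1 + Real.exp t)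

theorem logistic_eq_sigmoid : logistic = Real.sigmoid := by
  ext t
  rw [logistic, Real.sigmoid_def, Real.exp_neg]
  field_simp
  ring

theorem logistic_pos (t : ℝ) : 0 < logistic t :=
  logistic_eq_sigmoid ▸ Real.sigmoid_pos t

theorem one_sub_logistic (t : ℝ) : 1 - logistic t = (1 + Real.exp t)⁻¹ := by
  rw [logistic]
  field_simp
  ring

theorem one_sub_logistic_pos (t : ℝ) : 0 < 1 - logistic t :=
  sub_pos.2 (logistic_eq_sigmoid ▸ Real.sigmoid_lt_one t)

theorem log_logistic (t : ℝ) : Real.log (logistic t) = t - logPartition t := by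
  rw [logistic, Real.log_div (Real.exp_ne_zero t) (by positivity), Real.log_exp, logPartition]

theorem log_one_sub_logistic (t : ℝ) : Real.log (1 - logistic t) = -logPartition t := by
  rw [one_sub_logistic, Real.log_inv, logPartition]

theorem hasDerivAt_logPartition (t : ℝ) : HasDerivAt logPartition (logistic t) t :=
  ((Real.hasDerivAt_exp t).const_add 1).log (by positivity)

theorem hasDerivAt_logistic (t : ℝ) :
    HasDerivAt logistic (logistic t * (1 - logistic t)) t := by
  rw [logistic_eq_sigmoid]
  exact Real.hasDerivAt_sigmoid t

theorem logistic_mul_one_sub_le (t : ℝ) : logistic t * (1 - logistic t) ≤ 1 / 4 := by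
  nlinarith [sq_nonneg (logistic t - 1 / 2)]

theorem exp_neg_abs_div_four_le (t : ℝ) :
    Real.exp (-|t|) / 4 ≤ logistic t * (1 - logistic t) := by
  wlog ht : 0 ≤ t generalizing t
  · have := this (-t) (by linarith)
    simpa [logistic_eq_sigmoid, Real.sigmoid_neg, mul_comm] using this
  have hhalf : 1 / 2 ≤ logistic t := by
    rw [logistic, div_le_div_iff₀ two_pos (by positivity)]
    linarith [Real.one_le_exp ht]
  have hexp : 1 - logistic t = logistic t * Real.exp (-t) := by
    rw [logistic_eq_sigmoid, Real.sigmoid_mul_rexp_neg, Real.sigmoid_neg]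
  rw [abs_of_nonneg ht, hexp]
  nlinarith [Real.exp_pos (-t), mul_self_le_mul_self (by norm_num) hhalf]

theorem exp_div_eight_mul_sq_le_logPartition_sub {B u v : ℝ} (hu : |u| ≤ B) (hv : |v| ≤ B) :
    Real.exp (-B) / 8 * (v - u) ^ 2 ≤
      logPartition v - logPartition u - logistic u * (v - u) := by
  have hcurv : ∀ t ∈ Set.Icc (-B) B, Real.exp (-B) / 4 ≤ logistic t * (1 - logistic t) :=
    fun t ht => le_trans (by gcongr; exact abs_le.2 ht) (exp_neg_abs_div_four_le t)
  have := add_mul_sub_add_sq_le_of_le_deriv2 (convex_Icc (-B) B)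
    (fun t _ => hasDerivAt_logPartition t) (fun t _ => hasDerivAt_logistic t) hcurv
    (abs_le.1 hu) (abs_le.1 hv)
  linarith

theorem logPartition_sub_le_sq_div_eight (u v : ℝ) :
    logPartition v - logPartition u - logistic u * (v - u) ≤ (v - u) ^ 2 / 8 := by
  have := add_mul_sub_add_sq_le_of_le_deriv2 convex_univ
    (fun t _ => (hasDerivAt_logPartition t).neg) (fun t _ => (hasDerivAt_logistic t).neg)
    (fun t _ => neg_le_neg (logistic_mul_one_sub_le t)) (Set.mem_univ u) (Set.mem_univ v)
  simp only [Pi.neg_apply] at this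
  linarith

end Logistic

section Gaussian

open ProbabilityTheory

theorem integral_exp_mul_sq_gaussianReal (t : ℝ) :
    ∫ g, Real.exp (t * g ^ 2) ∂(gaussianReal 0 1) = (√(1 - 2 * t))⁻¹ := by
  have hpdf (g : ℝ) : gaussianPDFReal 0 1 g • Real.exp (t * g ^ 2) =
      (√(2 * Real.pi))⁻¹ * Real.exp (-(1 / 2 - t) * g ^ 2) := by
    rw [gaussianPDFReal, smul_eq_mul, mul_assoc, ← Real.exp_add]
    simp only [NNReal.coe_one, mul_one]
    ring_nf
  simp only [integral_gaussianReal_eq_integral_smul one_ne_zero, hpdf]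
  rw [integral_const_mul, integral_gaussian, ← Real.sqrt_inv, ← Real.sqrt_mul (by positivity),
    ← Real.sqrt_inv]
  congr 1
  rw [show 1 - 2 * t = 2 * (1 / 2 - t) by ring, mul_inv, mul_inv, div_eq_mul_inv]
  field_simp

variable {E : Type*} [NormedAddCommGroup E] [InnerProductSpace ℝ E] [FiniteDimensional ℝ E]
  [MeasurableSpace E] [BorelSpace E]

theorem integral_exp_inner_stdGaussian (v : E) :
    ∫ g, Real.exp (inner ℝ v g) ∂(stdGaussian E) = Real.exp (‖v‖ ^ 2 / 2) := by
  have hmap : (stdGaussian E).map (innerSL ℝ v) = gaussianReal 0 (‖v‖ ^ 2).toNNReal := by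
    rw [IsGaussian.map_eq_gaussianReal, integral_strongDual_stdGaussian,
      variance_dual_stdGaussian, innerSL_apply_norm]
  have hmgf := mgf_gaussianReal hmap 1
  simpa [mgf, sq_nonneg] using hmgf

theorem integral_exp_mul_norm_sq_stdGaussian (t : ℝ) :
    ∫ g, Real.exp (t * ‖g‖ ^ 2) ∂(stdGaussian E) =
      (√(1 - 2 * t))⁻¹ ^ Module.finrank ℝ E := by
  let b := stdOrthonormalBasis ℝ E
  have hnorm (x : Fin (Module.finrank ℝ E) → ℝ) :
      Real.exp (t * ‖∑ i, x i • b i‖ ^ 2) = ∏ i, Real.exp (t * x i ^ 2) := by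
    simp only [← b.sum_sq_inner_right, b.orthonormal.inner_right_fintype, Finset.mul_sum,
      Real.exp_sum]
  rw [stdGaussian, integral_map (Measurable.aemeasurable (by fun_prop)) (by fun_prop)]
  simp only [b] at hnorm
  simp only [hnorm]
  rw [integral_fintype_prod_eq_pow fun s : ℝ => Real.exp (t * s ^ 2),
    integral_exp_mul_sq_gaussianReal, Fintype.card_fin]

end Gaussian

section SubgaussianVector

open ProbabilityTheory
open scoped NNReal

variable {Ω E : Type*} [MeasurableSpace Ω] {μ : Measure Ω}
  [NormedAddCommGroup E] [InnerProductSpace ℝ E]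

/-- A random vector is sub-Gaussian with variance proxy `c` if, for every vector `a`, its inner
product with `a` is a real sub-Gaussian variable with variance proxy `c * ‖a‖ ^ 2`; like
`HasSubgaussianMGF`, this forces the vector to be centred. -/
def IsSubgaussianVector (Z : Ω → E) (c : ℝ≥0) (μ : Measure Ω) : Prop :=
  ∀ a, HasSubgaussianMGF (fun ω => inner ℝ (Z ω) a) (c * ‖a‖₊ ^ 2) μ

namespace IsSubgaussianVector

theorem of_iIndepFun {ι : Type*} [Fintype ι] {Z : Ω → EuclideanSpace ℝ ι} {c : ℝ≥0}
    (hind : iIndepFun (fun i ω => Z ω i) μ) (hZ : ∀ i, HasSubgaussianMGF (fun ω => Z ω i) c μ) :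
    IsSubgaussianVector Z c μ := fun a => by
  have hsum := HasSubgaussianMGF.sum_of_iIndepFun (s := Finset.univ)
    (hind.comp (fun i s => a i * s) fun i => measurable_const_mul (a i))
    fun i _ => (hZ i).const_mul (a i)
  have hproxy : c * ‖a‖₊ ^ 2 = ∑ i, ⟨a i ^ 2, sq_nonneg (a i)⟩ * c := by
    ext
    push_cast
    rw [EuclideanSpace.real_norm_sq_eq, Finset.mul_sum]
    exact Finset.sum_congr rfl fun i _ => mul_comm _ _
  rw [hproxy]
  exact hsum

theorem orthogonalProjectionOnto {Z : Ω → E} {c : ℝ≥0} (hZ : IsSubgaussianVector Z c μ)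
    (V : Submodule ℝ E) [V.HasOrthogonalProjection] :
    IsSubgaussianVector (fun ω => V.orthogonalProjectionOnto (Z ω)) c μ := fun a => by
  simp only [Submodule.inner_orthogonalProjectionOnto_eq_of_mem_right]
  exact hZ (a : E)

variable [FiniteDimensional ℝ E]

theorem aemeasurable [MeasurableSpace E] [BorelSpace E] {Z : Ω → E} {c : ℝ≥0}
    (hZ : IsSubgaussianVector Z c μ) : AEMeasurable Z μ := by
  let b := stdOrthonormalBasis ℝ E
  have hsum : Z = fun ω => ∑ i, inner ℝ (Z ω) (b i) • b i := by
    ext ω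
    exact (b.sum_repr' (Z ω)).symm.trans (by simp only [real_inner_comm])
  rw [hsum]
  exact Finset.aemeasurable_fun_sum _ fun i _ => (hZ (b i)).aemeasurable.smul_const _

variable [SFinite μ]

theorem lintegral_exp_mul_norm_sq_le {Z : Ω → E} {c : ℝ≥0} (hZ : IsSubgaussianVector Z c μ)
    {t : ℝ} (ht : 0 ≤ t) (htc : 2 * (c * t) < 1) :
    ∫⁻ ω, .ofReal (Real.exp (t * ‖Z ω‖ ^ 2)) ∂μ ≤
      .ofReal ((√(1 - 2 * (c * t)))⁻¹ ^ Module.finrank ℝ E) := by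
  borelize E
  have hsq (v : E) : ‖√(2 * t) • v‖ ^ 2 = 2 * t * ‖v‖ ^ 2 := by
    rw [norm_smul, mul_pow, Real.norm_eq_abs, sq_abs, Real.sq_sqrt (by positivity)]
  have hlin (z : E) : ENNReal.ofReal (Real.exp (t * ‖z‖ ^ 2)) =
      ∫⁻ g, .ofReal (Real.exp (inner ℝ (√(2 * t) • z) g)) ∂(stdGaussian E) := by
    have hint := integral_exp_inner_stdGaussian (√(2 * t) • z)
    rw [← ofReal_integral_eq_lintegral_ofReal (.of_integral_ne_zero (by rw [hint]; positivity))
      (.of_forall fun _ => (Real.exp_pos _).le), hint, hsq]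
    ring_nf
  have hsub (g : E) : ∫⁻ ω, .ofReal (Real.exp (inner ℝ (√(2 * t) • Z ω) g)) ∂μ ≤
      ENNReal.ofReal (Real.exp (c * t * ‖g‖ ^ 2)) := by
    have hg := hZ (√(2 * t) • g)
    simp only [inner_smul_left_eq_smul, ← inner_smul_right_eq_smul]
    rw [← ofReal_integral_eq_lintegral_ofReal (by simpa using hg.integrable_exp_mul 1)
      (.of_forall fun _ => (Real.exp_pos _).le)]
    refine ENNReal.ofReal_le_ofReal ?_
    have := hg.mgf_le 1
    simp only [mgf, one_mul, NNReal.coe_mul, NNReal.coe_pow, coe_nnnorm, hsq] at this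
    exact this.trans_eq (by ring_nf)
  have hmeas : AEMeasurable (fun p : Ω × E =>
      ENNReal.ofReal (Real.exp (inner ℝ (√(2 * t) • Z p.1) p.2))) (μ.prod (stdGaussian E)) :=
    ((hZ.aemeasurable.comp_fst.const_smul _).inner measurable_snd.aemeasurable).exp.ennreal_ofReal
  have hnorm := integral_exp_mul_norm_sq_stdGaussian (E := E) (c * t)
  calc ∫⁻ ω, .ofReal (Real.exp (t * ‖Z ω‖ ^ 2)) ∂μ
      = ∫⁻ ω, ∫⁻ g, .ofReal (Real.exp (inner ℝ (√(2 * t) • Z ω) g)) ∂(stdGaussian E) ∂μ :=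
        lintegral_congr fun ω => hlin (Z ω)
    _ = ∫⁻ g, ∫⁻ ω, .ofReal (Real.exp (inner ℝ (√(2 * t) • Z ω) g)) ∂μ ∂(stdGaussian E) :=
        lintegral_lintegral_swap hmeas
    _ ≤ ∫⁻ g, .ofReal (Real.exp (c * t * ‖g‖ ^ 2)) ∂(stdGaussian E) := lintegral_mono hsub
    _ = .ofReal ((√(1 - 2 * (c * t)))⁻¹ ^ Module.finrank ℝ E) := by
        have hpos : 0 < √(1 - 2 * (c * t)) := Real.sqrt_pos.2 (by linarith)
        rw [← ofReal_integral_eq_lintegral_ofReal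
          (.of_integral_ne_zero (hnorm ▸ (pow_pos (inv_pos.2 hpos) _).ne'))
          (.of_forall fun _ => (Real.exp_pos _).le), hnorm]

theorem integral_exp_mul_norm_sq_le {Z : Ω → E} {c : ℝ≥0} (hZ : IsSubgaussianVector Z c μ)
    {t : ℝ} (ht : 0 ≤ t) (htc : 2 * (c * t) < 1) :
    ∫ ω, Real.exp (t * ‖Z ω‖ ^ 2) ∂μ ≤ (√(1 - 2 * (c * t)))⁻¹ ^ Module.finrank ℝ E := by
  borelize E
  have hmeas : AEMeasurable (fun ω => Real.exp (t * ‖Z ω‖ ^ 2)) μ :=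
    ((hZ.aemeasurable.norm.pow_const 2).const_mul t).exp
  rw [integral_eq_lintegral_of_nonneg_ae (.of_forall fun _ => (Real.exp_pos _).le)
    hmeas.aestronglyMeasurable]
  exact ENNReal.toReal_le_of_le_ofReal (by positivity) (hZ.lintegral_exp_mul_norm_sq_le ht htc)

theorem integral_exp_norm_sq_sub_le {Z : Ω → E} (hZ : IsSubgaussianVector Z (1 / 4) μ) (ℓ : ℝ) :
    ∫ ω, Real.exp (‖Z ω‖ ^ 2 - (Module.finrank ℝ E / 2 + ℓ)) ∂μ ≤ Real.exp (-ℓ) := by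
  have hsqrt : (√(1 - 2 * ((1 / 4 : ℝ≥0) * 1)))⁻¹ ≤ Real.exp (1 / 2) := by
    rw [← Real.sqrt_inv, Real.sqrt_le_left (by positivity), ← Real.exp_nat_mul]
    have := Real.add_one_le_exp (1 : ℝ)
    norm_num at this ⊢
    linarith
  have hmgf : ∫ ω, Real.exp (‖Z ω‖ ^ 2) ∂μ ≤ Real.exp (Module.finrank ℝ E / 2) :=
    calc ∫ ω, Real.exp (‖Z ω‖ ^ 2) ∂μ
        ≤ (√(1 - 2 * ((1 / 4 : ℝ≥0) * 1)))⁻¹ ^ Module.finrank ℝ E := by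
          simpa only [one_mul] using
            hZ.integral_exp_mul_norm_sq_le zero_le_one (by norm_num)
      _ ≤ Real.exp (1 / 2) ^ Module.finrank ℝ E := by gcongr
      _ = Real.exp (Module.finrank ℝ E / 2) := by rw [← Real.exp_nat_mul]; ring_nf
  simp only [Real.exp_sub]
  rw [integral_div, div_le_iff₀ (Real.exp_pos _), ← Real.exp_add]
  exact hmgf.trans_eq (by ring_nf)

end IsSubgaussianVector

end SubgaussianVector

section Atoms

variable {α : Type*} [MeasurableSpace α] {μ ν : Measure α}

theorem absolutelyContinuous_of_forall_singleton_ne_zero (hν : ∀ a, ν {a} ≠ 0) : μ ≪ ν :=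
  fun s hs => by
    have hempty : s = ∅ := Set.eq_empty_of_forall_notMem fun a ha =>
      hν a (measure_mono_null (Set.singleton_subset_iff.2 ha) hs)
    rw [hempty, measure_empty]

theorem rnDeriv_mul_measure_singleton [MeasurableSingletonClass α]
    [μ.HaveLebesgueDecomposition ν] (hμν : μ ≪ ν) (a : α) : μ.rnDeriv ν a * ν {a} = μ {a} := by
  rw [← lintegral_singleton, Measure.setLIntegral_rnDeriv' hμν (measurableSet_singleton a)]

end Atoms

section Law

variable {X : Type*} {n : ℕ}

instance isProbabilityMeasure_law (x : Fin n → X) (f : X → ℝ) :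
    IsProbabilityMeasure (law x f) := by
  unfold law
  infer_instance

theorem likelihood_pos (x : Fin n → X) (f : X → ℝ) (y : Fin n → Bool) : 0 < likelihood x f y :=
  Finset.prod_pos fun i _ => by
    split_ifs
    exacts [logistic_pos _, one_sub_logistic_pos _]

theorem law_singleton (x : Fin n → X) (f : X → ℝ) (y : Fin n → Bool) :
    law x f {y} = ENNReal.ofReal (likelihood x f y) := by
  rw [law, Measure.pi_singleton, likelihood, ENNReal.ofReal_prod_of_nonneg]
  · refine Finset.prod_congr rfl fun i _ => ?_
    rw [← ofReal_measureReal]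
    cases y i <;> simp
  · intro i _
    split_ifs
    exacts [(logistic_pos _).le, (one_sub_logistic_pos _).le]

theorem law_absolutelyContinuous (x : Fin n → X) (f g : X → ℝ) : law x f ≪ law x g :=
  absolutelyContinuous_of_forall_singleton_ne_zero fun y => by
    rw [law_singleton]
    exact (ENNReal.ofReal_pos.2 (likelihood_pos x g y)).ne'

theorem llr_law (x : Fin n → X) (f g : X → ℝ) (y : Fin n → Bool) :
    llr (law x f) (law x g) y = Real.log (likelihood x f y) - Real.log (likelihood x g y) := by
  have hratio := congrArg ENNReal.toReal
    (rnDeriv_mul_measure_singleton (law_absolutelyContinuous x f g) y)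
  rw [law_singleton, law_singleton, ENNReal.toReal_mul,
    ENNReal.toReal_ofReal (likelihood_pos x g y).le,
    ENNReal.toReal_ofReal (likelihood_pos x f y).le] at hratio
  rw [llr, ← Real.log_div (likelihood_pos x f y).ne' (likelihood_pos x g y).ne', ← hratio,
    mul_div_cancel_right₀ _ (likelihood_pos x g y).ne']

theorem kl_eq_contrast_sub (x : Fin n → X) (f₀ f : X → ℝ) :
    kl x f₀ f = contrast x f₀ f - contrast x f₀ f₀ := by
  rw [kl, InformationTheory.toReal_klDiv_of_measure_eq (law_absolutelyContinuous x f₀ f)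
    (by simp), contrast, contrast, ← integral_sub .of_finite .of_finite, ← integral_const_mul]
  refine integral_congr_ae (.of_forall fun y => ?_)
  simp only [llr_law, empContrast]
  ring

theorem empContrast_eq_sum (x : Fin n → X) (f : X → ℝ) (y : Fin n → Bool) :
    empContrast x f y =
      1 / (n : ℝ) * ∑ i, (logPartition (f (x i)) - (if y i = true then 1 else 0) * f (x i)) := by
  rw [empContrast, likelihood, Real.log_prod, neg_mul, ← mul_neg, ← Finset.sum_neg_distrib]
  · congr 1
    refine Finset.sum_congr rfl fun i _ => ?_
    split_ifs
    · rw [log_logistic]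
      ring
    · rw [log_one_sub_logistic]
      ring
  · intro i _
    split_ifs
    exacts [(logistic_pos _).ne', (one_sub_logistic_pos _).ne']

theorem integral_observation (x : Fin n → X) (f₀ : X → ℝ) (i : Fin n) :
    ∫ y, (if y i = true then 1 else 0 : ℝ) ∂(law x f₀) = logistic (f₀ (x i)) := by
  refine (integral_comp_eval (μ := fun i => ProbabilityTheory.bernoulliMeasure true false
    ⟨logistic (f₀ (x i)), logistic_mem (f₀ (x i))⟩)
    (f := fun b : Bool => if b = true then (1 : ℝ) else 0) (by fun_prop)).trans ?_
  simp [ProbabilityTheory.integral_bernoulliMeasure]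

theorem contrast_eq_sum (x : Fin n → X) (f₀ f : X → ℝ) :
    contrast x f₀ f =
      1 / (n : ℝ) * ∑ i, (logPartition (f (x i)) - logistic (f₀ (x i)) * f (x i)) := by
  simp only [contrast, empContrast_eq_sum]
  rw [integral_const_mul, integral_finsetSum _ fun _ _ => .of_finite]
  congr 1
  refine Finset.sum_congr rfl fun i _ => ?_
  rw [integral_sub .of_finite .of_finite, integral_mul_const, integral_observation]
  simp

theorem kl_eq_sum (x : Fin n → X) (f₀ f : X → ℝ) :
    kl x f₀ f = 1 / (n : ℝ) * ∑ i, (logPartition (f (x i)) - logPartition (f₀ (x i))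
      - logistic (f₀ (x i)) * (f (x i) - f₀ (x i))) := by
  rw [kl_eq_contrast_sub, contrast_eq_sum, contrast_eq_sum, ← mul_sub, ← Finset.sum_sub_distrib]
  congr 1
  exact Finset.sum_congr rfl fun i _ => by ring

theorem supBall_mono (x : Fin n → X) : Monotone (supBall x) :=
  fun _ _ hB _ hf i => (hf i).trans hB

theorem empNormSq_nonneg (x : Fin n → X) (f : X → ℝ) : 0 ≤ empNormSq x f := by
  unfold empNormSq
  positivity

theorem empNormSq_sub_le_kl {x : Fin n → X} {f₀ f : X → ℝ} {B : ℝ}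
    (h₀ : f₀ ∈ supBall x B) (h : f ∈ supBall x B) :
    Real.exp (-B) / 8 * empNormSq x (f - f₀) ≤ kl x f₀ f := by
  rw [kl_eq_sum, empNormSq, mul_left_comm, Finset.mul_sum]
  gcongr with i
  exact exp_div_eight_mul_sq_le_logPartition_sub (h₀ i) (h i)

theorem kl_le_empNormSq_sub (x : Fin n → X) (f₀ f : X → ℝ) :
    kl x f₀ f ≤ empNormSq x (f₀ - f) / 8 := by
  rw [kl_eq_sum, empNormSq, mul_div_assoc, Finset.sum_div]
  gcongr with i
  refine (logPartition_sub_le_sq_div_eight _ _).trans_eq ?_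
  rw [Pi.sub_apply]
  ring

theorem empNormSq_sub_le (x : Fin n → X) (f g h : X → ℝ) :
    empNormSq x (g - h) ≤ 2 * (empNormSq x (g - f) + empNormSq x (h - f)) := by
  simp only [empNormSq, ← mul_add, ← Finset.sum_add_distrib, mul_left_comm (2 : ℝ),
    Finset.mul_sum (a := (2 : ℝ))]
  gcongr with i
  simp only [Pi.sub_apply]
  linarith [sq_nonneg (g (x i) - f (x i) + (h (x i) - f (x i)))]

end Law

section Noise

open ProbabilityTheory

variable {X : Type*} {n : ℕ}

/-- The centred observation `(Yᵢ - π_{f₀}(xᵢ))ᵢ`, as a Euclidean vector. -/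
def noise (x : Fin n → X) (f₀ : X → ℝ) (y : Fin n → Bool) : EuclideanSpace ℝ (Fin n) :=
  WithLp.toLp 2 fun i => (if y i = true then 1 else 0) - logistic (f₀ (x i))

/-- Evaluation at the design points, `f ↦ (f(xᵢ))ᵢ`. Its values carry the unnormalized Euclidean
norm, so that `‖designMap x f‖² = n ‖f‖ₙ²`. -/
def designMap (x : Fin n → X) : (X → ℝ) →ₗ[ℝ] EuclideanSpace ℝ (Fin n) :=
  (WithLp.linearEquiv 2 ℝ (Fin n → ℝ)).symm.toLinearMap ∘ₗ LinearMap.funLeft ℝ ℝ x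

theorem designMap_apply (x : Fin n → X) (f : X → ℝ) (i : Fin n) : designMap x f i = f (x i) := rfl

theorem norm_designMap_sq (x : Fin n → X) (f : X → ℝ) :
    ‖designMap x f‖ ^ 2 = n * empNormSq x f := by
  rcases eq_or_ne n 0 with rfl | hn
  · simp [EuclideanSpace.real_norm_sq_eq]
  · simp only [EuclideanSpace.real_norm_sq_eq, empNormSq, designMap_apply]
    field_simp

theorem empContrast_eq_contrast_sub_inner (x : Fin n → X) (f₀ f : X → ℝ) (y : Fin n → Bool) :
    empContrast x f y =
      contrast x f₀ f - 1 / (n : ℝ) * inner ℝ (noise x f₀ y) (designMap x f) := by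
  rw [empContrast_eq_sum, contrast_eq_sum, ← mul_sub, PiLp.inner_apply, ← Finset.sum_sub_distrib]
  congr 1
  refine Finset.sum_congr rfl fun i _ => ?_
  simp only [noise, designMap_apply, RCLike.inner_apply, conj_trivial]
  ring

theorem isSubgaussianVector_noise (x : Fin n → X) (f₀ : X → ℝ) :
    IsSubgaussianVector (noise x f₀) (1 / 4) (law x f₀) := by
  refine .of_iIndepFun (iIndepFun_pi (X := fun i (b : Bool) =>
    (if b = true then 1 else 0) - logistic (f₀ (x i))) fun i => by fun_prop) fun i => ?_
  have hoeffding := hasSubgaussianMGF_of_mem_Icc (a := 0) (b := 1) (μ := law x f₀)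
    (X := fun y => if y i = true then 1 else 0) (by fun_prop)
    (.of_forall fun y => by split_ifs <;> simp)
  rw [integral_observation] at hoeffding
  convert! hoeffding using 1
  ext
  norm_num

end Noise

section Selection

theorem integral_apply_selection_le_tsum {Ω ι : Type*} [MeasurableSpace Ω] {μ : Measure Ω}
    [Countable ι] {R : ι → Ω → ℝ} {r : ι → ℝ} (hR : ∀ k ω, 0 ≤ R k ω)
    (hint : ∀ k, Integrable (R k) μ) (hr : ∀ k, ∫ ω, R k ω ∂μ ≤ r k) (hsum : Summable r)
    (sel : Ω → ι) : ∫ ω, R (sel ω) ω ∂μ ≤ ∑' k, r k := by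
  have hr₀ (k : ι) : 0 ≤ r k := (integral_nonneg (hR k)).trans (hr k)
  have hlint : ∫⁻ ω, .ofReal ‖R (sel ω) ω‖ ∂μ ≤ ENNReal.ofReal (∑' k, r k) :=
    calc ∫⁻ ω, .ofReal ‖R (sel ω) ω‖ ∂μ
        ≤ ∫⁻ ω, ∑' k, .ofReal (R k ω) ∂μ := lintegral_mono fun ω => by
          rw [Real.norm_of_nonneg (hR _ _)]
          exact ENNReal.le_tsum (sel ω)
      _ = ∑' k, .ofReal (∫ ω, R k ω ∂μ) := by
          rw [lintegral_tsum fun k => (hint k).aemeasurable.ennreal_ofReal]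
          exact tsum_congr fun k =>
            (ofReal_integral_eq_lintegral_ofReal (hint k) (.of_forall (hR k))).symm
      _ ≤ ∑' k, .ofReal (r k) := ENNReal.tsum_le_tsum fun k => ENNReal.ofReal_le_ofReal (hr k)
      _ = .ofReal (∑' k, r k) := (ENNReal.ofReal_tsum_of_nonneg hr₀ hsum).symm
  exact (le_abs_self _).trans <| (norm_integral_le_lintegral_norm _).trans <|
    ENNReal.toReal_le_of_le_ofReal (tsum_nonneg hr₀) hlint

theorem le_mul_iInf_add {ι : Type*} [Nonempty ι] {a b C : ℝ} {F : ι → ℝ} (hC : 0 ≤ C)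
    (h : ∀ k, a ≤ C * F k + b) : a ≤ C * (⨅ k, F k) + b := by
  rw [Real.mul_iInf_of_nonneg hC, ← sub_le_iff_le_add]
  exact le_ciInf fun k => sub_le_iff_le_add.2 (h k)

end Selection

section Fluctuation

variable {X : Type*} {n : ℕ}

theorem finrank_map_sup_span_singleton_le {K V W : Type*} [DivisionRing K] [AddCommGroup V]
    [Module K V] [AddCommGroup W] [Module K W] (T : V →ₗ[K] W) (S : Submodule K V)
    [FiniteDimensional K S] (v : V) :
    Module.finrank K ((S ⊔ K ∙ v).map T) ≤ Module.finrank K S + 1 :=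
  calc Module.finrank K ((S ⊔ K ∙ v).map T)
      ≤ Module.finrank K ↥(S ⊔ K ∙ v) := Submodule.finrank_map_le T _
    _ ≤ Module.finrank K S + Module.finrank K (K ∙ v) :=
        Submodule.finrank_add_le_finrank_add_finrank _ _
    _ ≤ Module.finrank K S + 1 := by
        gcongr
        simpa using finrank_span_le_card (R := K) {v}

theorem inner_le_mul_norm_sq_add_of_mem {E : Type*} [NormedAddCommGroup E]
    [InnerProductSpace ℝ E] {V : Submodule ℝ E} [V.HasOrthogonalProjection] (z : E) {v : E}
    (hv : v ∈ V) {δ : ℝ} (hδ : 0 < δ) :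
    inner ℝ z v ≤ δ * ‖v‖ ^ 2 + ‖V.orthogonalProjectionOnto z‖ ^ 2 / (4 * δ) := by
  have hproj : inner ℝ z v ≤ ‖V.orthogonalProjectionOnto z‖ * ‖v‖ :=
    calc inner ℝ z v = inner ℝ (V.orthogonalProjectionOnto z) ⟨v, hv⟩ :=
          (Submodule.inner_orthogonalProjectionOnto_eq_of_mem_right ⟨v, hv⟩ z).symm
      _ ≤ ‖V.orthogonalProjectionOnto z‖ * ‖v‖ := real_inner_le_norm _ _
  refine hproj.trans ?_
  have hsq := sq_nonneg (‖V.orthogonalProjectionOnto z‖ / (2 * √δ) - √δ * ‖v‖)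
  have hδ' : √δ ^ 2 = δ := Real.sq_sqrt hδ.le
  have := Real.sqrt_pos.2 hδ
  rw [sub_sq, div_pow, mul_pow, mul_pow, hδ'] at hsq
  field_simp at hsq ⊢
  linarith

/-- The random fluctuation term of the model `S` relative to the competitor `h`: the squared norm of
the noise projected onto the design values of `S + ℝ h`, which contains all the differences `g - h`,
`g ∈ S`. -/
def fluctuation (x : Fin n → X) (f₀ : X → ℝ) (S : Submodule ℝ (X → ℝ)) (h : X → ℝ)
    (y : Fin n → Bool) : ℝ :=
  ‖((S ⊔ ℝ ∙ h).map (designMap x)).orthogonalProjectionOnto (noise x f₀ y)‖ ^ 2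

theorem integral_exp_fluctuation_sub_le (x : Fin n → X) (f₀ : X → ℝ) (S : Submodule ℝ (X → ℝ))
    [FiniteDimensional ℝ S] (h : X → ℝ) (ℓ : ℝ) :
    ∫ y, Real.exp (fluctuation x f₀ S h y - ((Module.finrank ℝ S + 1) / 2 + ℓ)) ∂(law x f₀) ≤
      Real.exp (-ℓ) := by
  set V := (S ⊔ ℝ ∙ h).map (designMap x)
  have hdim : (Module.finrank ℝ V : ℝ) ≤ Module.finrank ℝ S + 1 := by
    exact_mod_cast finrank_map_sup_span_singleton_le (designMap x) S h
  refine le_trans (integral_mono .of_finite .of_finite fun y => ?_)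
    (((isSubgaussianVector_noise x f₀).orthogonalProjectionOnto V).integral_exp_norm_sq_sub_le ℓ)
  dsimp only [fluctuation]
  gcongr

theorem kl_le_of_empContrast_add_le {x : Fin n → X} {f₀ g h : X → ℝ} {S : Submodule ℝ (X → ℝ)}
    {B p q : ℝ} {y : Fin n → Bool} (hn : 0 < n) (hf₀ : f₀ ∈ supBall x B) (hgS : g ∈ S)
    (hg : g ∈ supBall x B) (hh : h ∈ supBall x B)
    (hmin : empContrast x g y + p ≤ empContrast x h y + q) :
    kl x f₀ g ≤ 3 * kl x f₀ h + 2 * (q - p) + 16 * Real.exp B / n * fluctuation x f₀ S h y := by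
  have hn' : (0 : ℝ) < n := Nat.cast_pos.2 hn
  have hbasic : kl x f₀ g + p ≤
      kl x f₀ h + q + 1 / (n : ℝ) * inner ℝ (noise x f₀ y) (designMap x (g - h)) := by
    rw [empContrast_eq_contrast_sub_inner x f₀, empContrast_eq_contrast_sub_inner x f₀] at hmin
    rw [kl_eq_contrast_sub, kl_eq_contrast_sub, map_sub, inner_sub_right, mul_sub]
    linarith
  have hdiff : Real.exp (-B) / 8 * empNormSq x (g - h) ≤ 2 * (kl x f₀ g + kl x f₀ h) := by
    have htri := mul_le_mul_of_nonneg_left (empNormSq_sub_le x f₀ g h)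
      (by positivity : 0 ≤ Real.exp (-B) / 8)
    linarith [empNormSq_sub_le_kl hf₀ hg, empNormSq_sub_le_kl hf₀ hh]
  have hmem : designMap x (g - h) ∈ (S ⊔ ℝ ∙ h).map (designMap x) :=
    Submodule.mem_map_of_mem <| sub_mem (Submodule.mem_sup_left hgS)
      (Submodule.mem_sup_right (Submodule.mem_span_singleton_self h))
  have hinner := inner_le_mul_norm_sq_add_of_mem (noise x f₀ y) hmem
    (by positivity : 0 < Real.exp (-B) / 8 / 4)
  have hnoise : 1 / (n : ℝ) * inner ℝ (noise x f₀ y) (designMap x (g - h)) ≤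
      (kl x f₀ g + kl x f₀ h) / 2 + 8 * Real.exp B / n * fluctuation x f₀ S h y :=
    calc 1 / (n : ℝ) * inner ℝ (noise x f₀ y) (designMap x (g - h))
        ≤ 1 / (n : ℝ) * (Real.exp (-B) / 8 / 4 * (n * empNormSq x (g - h)) +
            fluctuation x f₀ S h y / (4 * (Real.exp (-B) / 8 / 4))) := by
          rw [← norm_designMap_sq]
          gcongr
          exact hinner
      _ = Real.exp (-B) / 8 * empNormSq x (g - h) / 4 +
            8 * Real.exp B / n * fluctuation x f₀ S h y := by
          rw [Real.exp_neg]
          field_simp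
      _ ≤ _ := by linarith
  linear_combination 2 * hbasic + 2 * hnoise

theorem half_add_le_two_mul_sq {L : ℝ} (hL : 0 ≤ L) : 1 / 2 + L ≤ 2 * (1 / 2 + √(5 * L)) ^ 2 := by
  have hsq : √(5 * L) ^ 2 = 5 * L := Real.sq_sqrt (by positivity)
  nlinarith [Real.sqrt_nonneg (5 * L)]

theorem kl_le_of_penalized_le {x : Fin n → X} {f₀ g h : X → ℝ} {S : Submodule ℝ (X → ℝ)}
    {B L p q : ℝ} {y : Fin n → Bool} (hn : 0 < n) (hL : 0 ≤ L) (hf₀ : f₀ ∈ supBall x B)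
    (hgS : g ∈ S) (hg : g ∈ supBall x B) (hh : h ∈ supBall x B)
    (hp : 16 * Real.exp B * (Module.finrank ℝ S / (n : ℝ)) * (1 / 2 + √(5 * L)) ^ 2 ≤ p)
    (hmin : empContrast x g y + p ≤ empContrast x h y + q) :
    kl x f₀ g ≤ 3 * kl x f₀ h + 2 * q + 16 * Real.exp B / n *
      Real.exp (fluctuation x f₀ S h y -
        ((Module.finrank ℝ S + 1) / 2 + L * Module.finrank ℝ S)) := by
  set D := (Module.finrank ℝ S : ℝ)
  set χ := fluctuation x f₀ S h y
  have hpath := kl_le_of_empContrast_add_le hn hf₀ hgS hg hh hmin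
  have hpen : 16 * Real.exp B / n * (D / 2 + L * D) ≤ 2 * p :=
    calc 16 * Real.exp B / n * (D / 2 + L * D)
        = 16 * Real.exp B * (D / n) * (1 / 2 + L) := by ring
      _ ≤ 16 * Real.exp B * (D / n) * (2 * (1 / 2 + √(5 * L)) ^ 2) := by
          gcongr
          exact half_add_le_two_mul_sq hL
      _ ≤ 2 * p := by linarith
  have hχ : χ ≤ D / 2 + L * D + Real.exp (χ - ((D + 1) / 2 + L * D)) := by
    linarith [Real.add_one_le_exp (χ - ((D + 1) / 2 + L * D))]
  have := mul_le_mul_of_nonneg_left hχ (by positivity : 0 ≤ 16 * Real.exp B / n)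
  linarith

end Fluctuation

section Risk

variable {X : Type*} {n : ℕ} {ι : Type*}

theorem integral_kl_le {x : Fin n → X} {f₀ h : X → ℝ} {B q : ℝ}
    {S : ι → Submodule ℝ (X → ℝ)} [∀ m, FiniteDimensional ℝ (S m)] {L pen : ι → ℝ}
    {mhat : (Fin n → Bool) → ι} {g : (Fin n → Bool) → X → ℝ} (hn : 0 < n)
    (hf₀ : f₀ ∈ supBall x B) (hL : ∀ m, 0 ≤ L m)
    (hsum : Summable fun m => Real.exp (-(L m * Module.finrank ℝ (S m))))
    (hpen : ∀ m, 16 * Real.exp B * (Module.finrank ℝ (S m) / (n : ℝ)) *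
      (1 / 2 + √(5 * L m)) ^ 2 ≤ pen m)
    (hgS : ∀ y, g y ∈ S (mhat y)) (hg : ∀ y, g y ∈ supBall x B) (hh : h ∈ supBall x B)
    (hmin : ∀ y, empContrast x (g y) y + pen (mhat y) ≤ empContrast x h y + q) :
    ∫ y, kl x f₀ (g y) ∂(law x f₀) ≤ 3 * kl x f₀ h + 2 * q +
      16 * Real.exp B * ((∑' m, Real.exp (-(L m * Module.finrank ℝ (S m)))) / n) := by
  have : Countable ι := by
    simpa [Set.countable_univ_iff, Function.support_eq_univ] using hsum.countable_support
  let R (m : ι) (y : Fin n → Bool) : ℝ := Real.exp (fluctuation x f₀ (S m) h y -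
    ((Module.finrank ℝ (S m) + 1) / 2 + L m * Module.finrank ℝ (S m)))
  have hR : ∫ y, R (mhat y) y ∂(law x f₀) ≤
      ∑' m, Real.exp (-(L m * Module.finrank ℝ (S m))) :=
    integral_apply_selection_le_tsum (fun _ _ => (Real.exp_pos _).le) (fun _ => .of_finite)
      (fun m => integral_exp_fluctuation_sub_le x f₀ (S m) h _) hsum mhat
  calc ∫ y, kl x f₀ (g y) ∂(law x f₀)
      ≤ ∫ y, (3 * kl x f₀ h + 2 * q + 16 * Real.exp B / n * R (mhat y) y) ∂(law x f₀) :=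
        integral_mono .of_finite .of_finite fun y =>
          kl_le_of_penalized_le hn (hL _) hf₀ (hgS y) (hg y) hh (hpen _) (hmin y)
    _ = 3 * kl x f₀ h + 2 * q + 16 * Real.exp B / n * ∫ y, R (mhat y) y ∂(law x f₀) := by
        rw [integral_add .of_finite .of_finite, integral_const, integral_const_mul]
        simp
    _ ≤ 3 * kl x f₀ h + 2 * q + 16 * Real.exp B / n *
          ∑' m, Real.exp (-(L m * Module.finrank ℝ (S m))) := by gcongr
    _ = _ := by ring

theorem integral_empNormSq_sub_le {x : Fin n → X} {f₀ : X → ℝ} {B : ℝ}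
    {g : (Fin n → Bool) → X → ℝ} (hf₀ : f₀ ∈ supBall x B) (hg : ∀ y, g y ∈ supBall x B) :
    ∫ y, empNormSq x (g y - f₀) ∂(law x f₀) ≤
      8 * Real.exp B * ∫ y, kl x f₀ (g y) ∂(law x f₀) := by
  rw [← integral_const_mul]
  refine integral_mono .of_finite .of_finite fun y => ?_
  have := empNormSq_sub_le_kl hf₀ (hg y)
  rw [Real.exp_neg] at this
  field_simp at this
  linarith

end Risk

end LogisticSelection

end

open LogisticSelection in
theorem mainTheorem1_general {X ι : Type*} {n : ℕ} (hn : 0 < n) {x : Fin n → X} {f₀ : X → ℝ}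
    {B : ℝ} (hf₀ : f₀ ∈ supBall x B) {S : ι → Submodule ℝ (X → ℝ)}
    [∀ m, FiniteDimensional ℝ (S m)] {L pen : ι → ℝ} (hL : ∀ m, 0 ≤ L m)
    (hsum : Summable fun m => Real.exp (-(L m * Module.finrank ℝ (S m))))
    (hpen : ∀ m, 16 * Real.exp B * (Module.finrank ℝ (S m) / (n : ℝ)) *
      (1 / 2 + √(5 * L m)) ^ 2 ≤ pen m)
    {f : ι → X → ℝ} (hf : ∀ m, f m ∈ supBall x B)
    {mhat : (Fin n → Bool) → ι} {g : (Fin n → Bool) → X → ℝ}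
    (hgS : ∀ y, g y ∈ S (mhat y)) (hg : ∀ y, g y ∈ supBall x B)
    (hmin : ∀ y m, empContrast x (g y) y + pen (mhat y) ≤ empContrast x (f m) y + pen m) :
    ∫ y, kl x f₀ (g y) ∂(law x f₀) ≤ 3 * (⨅ m, (kl x f₀ (f m) + pen m)) +
        16 * Real.exp B * ((∑' m, Real.exp (-(L m * Module.finrank ℝ (S m)))) / n) ∧
      ∫ y, empNormSq x (g y - f₀) ∂(law x f₀) ≤
        16 * Real.exp B * (⨅ m, (empNormSq x (f₀ - f m) + pen m)) +
          128 * Real.exp (2 * B) *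
            ((∑' m, Real.exp (-(L m * Module.finrank ℝ (S m)))) / n) := by
  have : Nonempty ι := ⟨mhat fun _ => true⟩
  have hpen₀ (m : ι) : 0 ≤ pen m := le_trans (by positivity) (hpen m)
  have hrisk (m : ι) := integral_kl_le hn hf₀ hL hsum hpen hgS hg (hf m) (hmin · m)
  refine ⟨le_mul_iInf_add (by norm_num) fun m => ?_, le_mul_iInf_add (by positivity) fun m => ?_⟩
  · linarith [hrisk m, hpen₀ m]
  · set r := (∑' m, Real.exp (-(L m * Module.finrank ℝ (S m)))) / (n : ℝ)
    calc ∫ y, empNormSq x (g y - f₀) ∂(law x f₀)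
        ≤ 8 * Real.exp B * (3 * kl x f₀ (f m) + 2 * pen m + 16 * Real.exp B * r) :=
          (integral_empNormSq_sub_le hf₀ hg).trans (by gcongr; exact hrisk m)
      _ ≤ 8 * Real.exp B *
            (2 * (empNormSq x (f₀ - f m) + pen m) + 16 * Real.exp B * r) := by
          gcongr
          linarith [kl_le_empNormSq_sub x f₀ (f m), empNormSq_nonneg x (f₀ - f m)]
      _ = 16 * Real.exp B * (empNormSq x (f₀ - f m) + pen m) +
            128 * Real.exp (2 * B) * r := by
          rw [two_mul B, Real.exp_add]
          ring

theorem mainTheorem1 (c₁ C₀ : ℝ) (hc₁ : 0 < c₁) (hC₀ : 0 < C₀) :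
    ∃ lam C C' C₁ C₁' : ℝ, 0 < lam ∧ 0 < C ∧ 0 < C' ∧ 0 < C₁ ∧ 0 < C₁' ∧
      ∀ (X : Type*) (n : ℕ) (x : Fin n → X) (f₀ : X → ℝ)
        (J : Type*) (φ : J → X → ℝ) (M : Set (Finset J))
        (L pen : Finset J → ℝ)
        (fhat : Finset J → (Fin n → Bool) → X → ℝ)
        (f : Finset J → X → ℝ)
        (mhat : (Fin n → Bool) → Finset J),
        0 < n →
        (∀ i, |f₀ (x i)| ≤ c₁) →
        (∀ m ∈ M, 0 < L m) →
        (Summable fun m : M => Real.exp (-(L m * LogisticSelection.modelDim φ m.1))) →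
        (∀ m ∈ M, lam * (LogisticSelection.modelDim φ m / (n : ℝ))
            * (1 / 2 + Real.sqrt (5 * L m)) ^ 2 ≤ pen m) →
        (∀ m ∈ M, ∀ y, LogisticSelection.IsArgmin
            (fun t => LogisticSelection.empContrast x t y)
            ((LogisticSelection.model φ m : Set (X → ℝ)) ∩ LogisticSelection.supBall x C₀)
            (fhat m y)) →
        (∀ m ∈ M, LogisticSelection.IsArgmin
            (fun t => LogisticSelection.contrast x f₀ t)
            ((LogisticSelection.model φ m : Set (X → ℝ)) ∩ LogisticSelection.supBall x C₀)
            (f m)) →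
        (∀ y, LogisticSelection.IsArgmin
            (fun m => LogisticSelection.empContrast x (fhat m y) y + pen m) M (mhat y)) →
        (∫ y, LogisticSelection.kl x f₀ (fhat (mhat y) y) ∂(LogisticSelection.law x f₀)
            ≤ C * (⨅ m : M, (LogisticSelection.kl x f₀ (f m) + pen m))
              + C₁ * ((∑' m : M, Real.exp (-(L m * LogisticSelection.modelDim φ m.1))) / n)) ∧
        (∫ y, LogisticSelection.empNormSq x (fhat (mhat y) y - f₀) ∂(LogisticSelection.law x f₀)
            ≤ C' * (⨅ m : M, (LogisticSelection.empNormSq x (f₀ - f m) + pen m))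
              + C₁' * ((∑' m : M, Real.exp (-(L m * LogisticSelection.modelDim φ m.1))) / n)) := by
  refine ⟨16 * Real.exp (max c₁ C₀), 3, 16 * Real.exp (max c₁ C₀), 16 * Real.exp (max c₁ C₀),
    128 * Real.exp (2 * max c₁ C₀), by positivity, by positivity, by positivity, by positivity,
    by positivity, fun X n x f₀ J φ M L pen fhat f mhat hn hf₀ hL hsum hpen hfhat hf hmhat => ?_⟩
  have (m : M) : FiniteDimensional ℝ (LogisticSelection.model φ m) :=
    FiniteDimensional.span_of_finite ℝ (m.1.finite_toSet.image φ)
  have hC₀ := LogisticSelection.supBall_mono x (le_max_right c₁ C₀)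
  have hsel (y : Fin n → Bool) := hfhat (mhat y) (hmhat y).1 y
  exact mainTheorem1_general hn (LogisticSelection.supBall_mono x (le_max_left c₁ C₀) hf₀)
    (S := fun m : M => LogisticSelection.model φ m) (fun m => (hL m m.2).le) hsum
    (fun m => hpen m m.2) (fun m => hC₀ (hf m m.2).1.2)
    (mhat := fun y => ⟨mhat y, (hmhat y).1⟩) (fun y => (hsel y).1.1) (fun y => hC₀ (hsel y).1.2)
    fun y m => ((hmhat y).2 m m.2).trans
      (add_le_add_left ((hfhat m m.2 y).2 _ (hf m m.2).1) _)
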